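/- Let $d\ge 1$ and $M\ge 0$ be integers. A $d$-fold partition diamond of length $M$ consists of non-negative integers $\ell_0,\dots,\ell_M$ (the links) and $f_{n,i}$ for $1\le n\le M$, $1\le i\le d$ (the folds) such that $\ell_{n-1}\ge f_{n,i}\ge \ell_n$ for all $n$ and $i$. For each pair $(k,l)$ of non-negative integers, only finitely many of them satisfy $\sum_{n,i} f_{n,i}=k$ and $\sum_n \ell_n=l$; let $$\sigma_{d,M}(a,b)=\sum a^{\sum_{n,i} f_{n,i}}\,b^{\sum_{n}\ell_n},$$ a formal power series in $a$ and $b$, where the sum is over all $d$-fold partition diamonds of length $M$. For $\tau\in S_d$ put $\mathrm{Des}(\tau)=\{j\in\{1,\dots,d-1\}:\tau(j)>\tau(j+1)\}$, $\mathrm{des}(\tau)=|\mathrm{Des}(\tau)|$, $\mathrm{maj}(\tau)=\sum_{j\in \mathrm{Des}(\tau)}j$, and let $E_d(x,y)=\sum_{\tau\in S_d}x^{\mathrm{des}(\tau)}y^{\mathrm{maj}(\tau)}$ be the Euler--Mahonian polynomial. Then, in $\mathbb{Z}[[a,b]]$, where the denominator below is invertible, $$\sigma_{d,M}(a,b)=\frac{\prod_{n=1}^{M}E_d\bigl(a^{(n-1)d}b^n,\,a\bigr)}{\bigl(1-a^{Md}b^{M+1}\bigr)\prod_{n=1}^{M}\prod_{j=0}^{d}\bigl(1-a^{nd-j}b^n\bigr)}.$$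 -/

import Mathlib

/-- A `d`-fold partition diamond of length `M`: non-negative integers at the links
`0, …, M` and at the `d` folds of each of the `M` diamonds, where every fold of the `n`-th diamond
lies weakly below the link to its left and weakly above the link to its right. -/
@[ext]
structure PartitionDiamond (d M : ℕ) where
  /-- the parts at the links -/
  link : Fin (M + 1) → ℕ
  /-- the parts at the folds; `fold n i` is the `i`-th fold of the `n`-th diamond -/
  fold : Fin M → Fin d → ℕ
  fold_le_link : ∀ n i, fold n i ≤ link n.castSucc
  link_le_fold : ∀ n i, link n.succ ≤ fold n i

namespace PartitionDiamond

/-- The sum of the parts in the folds. -/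
def foldSum {d M : ℕ} (p : PartitionDiamond d M) : ℕ := ∑ n, ∑ i, p.fold n i

/-- The sum of the parts in the links. -/
def linkSum {d M : ℕ} (p : PartitionDiamond d M) : ℕ := ∑ n, p.link n

/-- The `d`-fold partition diamonds of length `M` whose folds sum to `k` and links sum to `l`. -/
def withSums (d M k l : ℕ) : Set (PartitionDiamond d M) :=
  {p | p.foldSum = k ∧ p.linkSum = l}

/-- The bivariate generating function `σ_{d,M}(a, b)`, a formal power series in `a` (variable `0`)
and `b` (variable `1`): the coefficient of `a ^ k * b ^ l` is the number of `d`-fold partition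
diamonds of length `M` with fold sum `k` and link sum `l`. -/
noncomputable def sigma (d M : ℕ) : MvPowerSeries (Fin 2) ℤ :=
  fun e => ((withSums d M (e 0) (e 1)).ncard : ℤ)

end PartitionDiamond

/-- The descents of a permutation of `Fin d`; the index `i : Fin d` stands for the
position `i + 1` in one-line notation. -/
def permDescents {d : ℕ} (τ : Equiv.Perm (Fin d)) : Finset (Fin d) :=
  {i : Fin d | ∃ h : (i : ℕ) + 1 < d, τ ⟨(i : ℕ) + 1, h⟩ < τ i}

/-- The number of descents. -/
def permDes {d : ℕ} (τ : Equiv.Perm (Fin d)) : ℕ := (permDescents τ).card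

/-- The major index: the sum of the descent positions, counted from `1`. -/
def permMaj {d : ℕ} (τ : Equiv.Perm (Fin d)) : ℕ := ∑ i ∈ permDescents τ, ((i : ℕ) + 1)

/-- The Euler–Mahonian polynomial `E_d(x, y)`, evaluated in a commutative ring. -/
def eulerMahonian (d : ℕ) {R : Type*} [CommRing R] (x y : R) : R :=
  ∑ τ : Equiv.Perm (Fin d), x ^ permDes τ * y ^ permMaj τ

/-- The numerator `∏_{n=1}^M E_d(a^{(n-1)d} b^n, a)`. -/
def diamondNumerator (d M : ℕ) {R : Type*} [CommRing R] (a b : R) : R :=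
  ∏ n ∈ Finset.Icc 1 M, eulerMahonian d (a ^ ((n - 1) * d) * b ^ n) a

/-- The denominator `(1 - a^{Md} b^{M+1}) ∏_{n=1}^M ∏_{j=0}^d (1 - a^{nd-j} b^n)`; the natural
number subtraction `n * d - j` is exact because `n ≥ 1` and `j ≤ d`. -/
def diamondDenominator (d M : ℕ) {R : Type*} [CommRing R] (a b : R) : R :=
  (1 - a ^ (M * d) * b ^ (M + 1)) *
    ∏ n ∈ Finset.Icc 1 M, ∏ j ∈ Finset.range (d + 1), (1 - a ^ (n * d - j) * b ^ n)

/-! Subtracting from each diamond the link on its right leaves a drop `m` and `d` numbers `g i ≤ m`.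
These `M` bounded tuples and the last link are independent (`equivBoundedTuples`). Counting diamonds
from `n = 0`, a unit of drop `m` at diamond `n` lifts the links `0, …, n` and all folds of the `n`
earlier diamonds, contributing `a ^ (d * n) * b ^ (n + 1)`; a unit of the last link lifts
everything. The weight is additive, so the series factors.

Each factor is Carlitz's identity (`blockWeight_series`). Sort `g` in descending order, ties by
increasing index, by `τ`. The gaps of `m ≥ g (τ 0) ≥ … ≥ 0` are arbitrary except that a descent of
`τ` forces a gap of at least 1 (`toBoundedTuple_bijective`). The forced gaps give the `des` and
`maj` powers. A free unit in gap `j` adds 1 to `m` and `j` to the sum of `g`, so the free parts give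
`d + 1` geometric series. -/

/-! ### Generating functions of weighted sets. -/

section WeightSeries

variable {σ S T : Type*}

/-- The generating function of a weighted set: the coefficient at `e` is the number of elements of
weight `e` (zero if there are infinitely many). -/
noncomputable def weightSeries (w : S → σ →₀ ℕ) : MvPowerSeries σ ℤ :=
  fun e => (Nat.card {s // w s = e} : ℤ)

/-- There are finitely many elements of each weight. -/
def FiniteWeights (w : S → σ →₀ ℕ) : Prop := ∀ e, Finite {s // w s = e}

theorem coeff_weightSeries (w : S → σ →₀ ℕ) (e : σ →₀ ℕ) :
    MvPowerSeries.coeff e (weightSeries w) = (Nat.card {s // w s = e} : ℤ) := rfl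

theorem weightSeries_congr_equiv (φ : S ≃ T) {w : S → σ →₀ ℕ} {v : T → σ →₀ ℕ}
    (h : ∀ s, v (φ s) = w s) : weightSeries w = weightSeries v := by
  ext e
  simp only [coeff_weightSeries, Nat.cast_inj]
  exact Nat.card_congr (φ.subtypeEquiv fun s => by rw [h])

theorem FiniteWeights.of_equiv (φ : S ≃ T) {w : S → σ →₀ ℕ} {v : T → σ →₀ ℕ}
    (h : ∀ s, v (φ s) = w s) (hv : FiniteWeights v) : FiniteWeights w := fun e =>
  have := hv e
  Finite.of_equiv _ (φ.subtypeEquiv fun s => by rw [h] : {s // w s = e} ≃ {t // v t = e}).symm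

/-- Pairs of total weight `e`, grouped by the weights of the components. -/
def pairWeightEquiv [DecidableEq σ] (w : S → σ →₀ ℕ) (v : T → σ →₀ ℕ) (e : σ →₀ ℕ) :
    {p : S × T // w p.1 + v p.2 = e} ≃
      Σ q : Finset.HasAntidiagonal.antidiagonal e, {s // w s = q.1.1} × {t // v t = q.1.2} where
  toFun p := ⟨⟨(w p.1.1, v p.1.2), by simpa using p.2⟩, ⟨p.1.1, rfl⟩, ⟨p.1.2, rfl⟩⟩
  invFun r := ⟨(r.2.1.1, r.2.2.1), by
    rw [r.2.1.2, r.2.2.2]; exact Finset.HasAntidiagonal.mem_antidiagonal.1 r.1.2⟩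
  left_inv p := rfl
  right_inv := by
    rintro ⟨⟨⟨x, y⟩, h⟩, ⟨s, hs⟩, ⟨t, ht⟩⟩
    dsimp only at hs ht
    subst hs ht
    rfl

theorem FiniteWeights.prod {w : S → σ →₀ ℕ} {v : T → σ →₀ ℕ} (hw : FiniteWeights w)
    (hv : FiniteWeights v) : FiniteWeights fun p : S × T => w p.1 + v p.2 := fun e => by
  classical
  have := hw
  have := hv
  have (q : Finset.HasAntidiagonal.antidiagonal e) := hw q.1.1
  have (q : Finset.HasAntidiagonal.antidiagonal e) := hv q.1.2
  exact Finite.of_equiv _ (pairWeightEquiv w v e).symm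

theorem weightSeries_prod {w : S → σ →₀ ℕ} {v : T → σ →₀ ℕ} (hw : FiniteWeights w)
    (hv : FiniteWeights v) :
    weightSeries (fun p : S × T => w p.1 + v p.2) = weightSeries w * weightSeries v := by
  classical
  ext e
  have (q : Finset.HasAntidiagonal.antidiagonal e) := hw q.1.1
  have (q : Finset.HasAntidiagonal.antidiagonal e) := hv q.1.2
  rw [MvPowerSeries.coeff_mul]
  simp only [coeff_weightSeries]
  rw [Nat.card_congr (pairWeightEquiv w v e), Nat.card_sigma,
    ← Finset.sum_coe_sort (Finset.HasAntidiagonal.antidiagonal e)]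
  simp [Nat.card_prod]

/-- Elements of weight `e` of a disjoint union, grouped by component. -/
def sigmaWeightEquiv {ι : Type*} {A : ι → Type*} (w : ∀ i, A i → σ →₀ ℕ) (e : σ →₀ ℕ) :
    {p : Σ i, A i // w p.1 p.2 = e} ≃ Σ i, {a // w i a = e} where
  toFun p := ⟨p.1.1, p.1.2, p.2⟩
  invFun r := ⟨⟨r.1, r.2.1⟩, r.2.2⟩
  left_inv _ := rfl
  right_inv _ := rfl

theorem FiniteWeights.sigma {ι : Type*} [Finite ι] {A : ι → Type*} {w : ∀ i, A i → σ →₀ ℕ}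
    (hw : ∀ i, FiniteWeights (w i)) : FiniteWeights fun p : Σ i, A i => w p.1 p.2 := fun e =>
  have (i : ι) := hw i e
  Finite.of_equiv _ (sigmaWeightEquiv w e).symm

theorem weightSeries_sigma {ι : Type*} [Fintype ι] {A : ι → Type*} {w : ∀ i, A i → σ →₀ ℕ}
    (hw : ∀ i, FiniteWeights (w i)) :
    weightSeries (fun p : Σ i, A i => w p.1 p.2) = ∑ i, weightSeries (w i) := by
  ext e
  have (i : ι) := hw i e
  rw [map_sum]
  simp only [coeff_weightSeries]
  rw [Nat.card_congr (sigmaWeightEquiv w e), Nat.card_sigma, Nat.cast_sum]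

theorem FiniteWeights.unique [Unique S] (w : S → σ →₀ ℕ) : FiniteWeights w := fun _ =>
  inferInstance

theorem weightSeries_unique [Unique S] (w : S → σ →₀ ℕ) :
    weightSeries w = MvPowerSeries.monomial (w default) 1 := by
  classical
  ext e
  rw [coeff_weightSeries, MvPowerSeries.coeff_monomial]
  split_ifs with h
  · have : Unique {s // w s = e} := ⟨⟨⟨default, h.symm⟩⟩, fun s => Subsingleton.elim _ _⟩
    simp
  · have : IsEmpty {s // w s = e} := ⟨fun s => h (by rw [← s.2, Unique.eq_default s.1])⟩
    simp

theorem FiniteWeights.const_add (u : σ →₀ ℕ) {w : S → σ →₀ ℕ} (hw : FiniteWeights w) :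
    FiniteWeights fun s => u + w s :=
  ((FiniteWeights.unique fun _ : Unit => u).prod hw).of_equiv (Equiv.punitProd S).symm
    fun _ => rfl

theorem weightSeries_const_add (u : σ →₀ ℕ) {w : S → σ →₀ ℕ} (hw : FiniteWeights w) :
    weightSeries (fun s => u + w s) = MvPowerSeries.monomial u 1 * weightSeries w := by
  rw [← weightSeries_unique fun _ : Unit => u, ← weightSeries_prod (.unique _) hw]
  exact weightSeries_congr_equiv (Equiv.punitProd S).symm fun _ => rfl

/-- Finiteness is carried through the induction because the binary product rule needs it: `Nat.card`
reads an infinite count as 0. -/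
theorem FiniteWeights.pi_and_weightSeries_pi {n : ℕ} {A : Fin n → Type*}
    {w : ∀ i, A i → σ →₀ ℕ} (hw : ∀ i, FiniteWeights (w i)) :
    FiniteWeights (fun f : ∀ i, A i => ∑ i, w i (f i)) ∧
      weightSeries (fun f : ∀ i, A i => ∑ i, w i (f i)) = ∏ i, weightSeries (w i) := by
  induction n with
  | zero => exact ⟨.unique _, by rw [weightSeries_unique]; simp⟩
  | succ n ih =>
    obtain ⟨h1, h2⟩ := ih (w := fun i : Fin n => w i.succ) fun i => hw i.succ
    have key (f : ∀ i, A i) : w 0 ((Fin.consEquiv A).symm f).1 +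
        ∑ i : Fin n, w i.succ (((Fin.consEquiv A).symm f).2 i) = ∑ i, w i (f i) := by
      rw [Fin.sum_univ_succ]; rfl
    refine ⟨((hw 0).prod h1).of_equiv (Fin.consEquiv A).symm key, ?_⟩
    rw [Fin.prod_univ_succ, ← h2, ← weightSeries_prod (hw 0) h1]
    exact weightSeries_congr_equiv (Fin.consEquiv A).symm key

theorem FiniteWeights.smul {m : σ →₀ ℕ} (hm : m ≠ 0) : FiniteWeights fun k : ℕ => k • m :=
  fun e => by
    have : Subsingleton {k : ℕ // k • m = e} := ⟨fun a b => Subtype.ext <| by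
      obtain ⟨i, hi⟩ := Finsupp.ne_iff.1 hm
      have := DFunLike.congr_fun (a.2.trans b.2.symm) i
      simpa [show m i ≠ 0 from hi] using this⟩
    infer_instance

/-- Geometric series: splitting off `k = 0` leaves a copy of the series shifted by `m`. -/
theorem weightSeries_smul_mul {m : σ →₀ ℕ} (hm : m ≠ 0) :
    weightSeries (fun k : ℕ => k • m) * (1 - MvPowerSeries.monomial m 1) = 1 := by
  have h : weightSeries (fun k : ℕ => k • m) =
      1 + MvPowerSeries.monomial m 1 * weightSeries (fun k : ℕ => k • m) := by
    classical
    rw [← weightSeries_const_add m (.smul hm)]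
    ext e
    have key := Nat.card_congr
      ((Equiv.natEquivNatSumPUnit.{1}.subtypeEquiv
        (p := fun k => k • m = e)
        (q := fun x => Sum.elim (fun k => m + k • m = e) (fun _ => 0 = e) x)
        (by rintro (_ | k) <;> simp [Equiv.natEquivNatSumPUnit, add_smul, add_comm])).trans
        Equiv.subtypeSum)
    have := (FiniteWeights.smul hm).const_add m e
    rw [map_add, coeff_weightSeries, coeff_weightSeries, key, MvPowerSeries.coeff_one]
    simp only [Sum.elim_inl, Sum.elim_inr]
    rw [Nat.card_sum, add_comm, Nat.cast_add]
    congr 1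
    by_cases he : e = 0
    · simp [he]
    · simp [he, Ne.symm he]
  linear_combination h

end WeightSeries

/-! ### Tuples and their consecutive differences. -/

section SuffixSums

/-- The sums of the final segments of a tuple. -/
def suffixSum {n : ℕ} (c : Fin n → ℕ) (i : Fin n) : ℕ := ∑ j ∈ Finset.Ici i, c j

theorem suffixSum_antitone {n : ℕ} (c : Fin n → ℕ) : Antitone (suffixSum c) := fun _ _ h =>
  Finset.sum_le_sum_of_subset (Finset.Ici_subset_Ici.2 h)

theorem suffixSum_zero {n : ℕ} (c : Fin (n + 1) → ℕ) : suffixSum c 0 = ∑ j, c j := by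
  simp [suffixSum, ← bot_eq_zero (α := Fin (n + 1))]

theorem suffixSum_last {n : ℕ} (c : Fin (n + 1) → ℕ) :
    suffixSum c (Fin.last n) = c (Fin.last n) := by
  simp [suffixSum, ← Fin.top_eq_last]

theorem suffixSum_castSucc {n : ℕ} (c : Fin (n + 1) → ℕ) (i : Fin n) :
    suffixSum c i.castSucc = c i.castSucc + suffixSum c i.succ := by
  have h : Finset.Ici i.castSucc = insert i.castSucc (Finset.Ici i.succ) := by
    ext j
    simp only [Finset.mem_Ici, Finset.mem_insert, Fin.le_def, Fin.ext_iff, Fin.val_castSucc,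
      Fin.val_succ]
    omega
  rw [suffixSum, h, Finset.sum_insert (by simp [Fin.le_def])]
  rfl

theorem eq_suffixSum_iff {n : ℕ} {c h : Fin (n + 1) → ℕ} :
    h = suffixSum c ↔ h (Fin.last n) = c (Fin.last n) ∧
      ∀ i : Fin n, h i.castSucc = c i.castSucc + h i.succ := by
  constructor
  · rintro rfl
    exact ⟨suffixSum_last c, suffixSum_castSucc c⟩
  · rintro ⟨h1, h2⟩
    ext i
    induction i using Fin.reverseInduction with
    | last => rw [h1, suffixSum_last]
    | cast i ih => rw [h2, suffixSum_castSucc, ih]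

theorem suffixSum_injective {n : ℕ} : Function.Injective (suffixSum (n := n + 1)) := by
  intro c c' h
  obtain ⟨h1, h2⟩ := eq_suffixSum_iff.1 h
  ext i
  induction i using Fin.lastCases with
  | last => rw [← h1, suffixSum_last]
  | cast i =>
    have := h2 i
    rw [suffixSum_castSucc] at this
    omega

/-- Double counting: `c j` occurs in the suffixes starting at `0, …, j`. -/
theorem sum_suffixSum {n : ℕ} (c : Fin n → ℕ) :
    ∑ i, suffixSum c i = ∑ j : Fin n, ((j : ℕ) + 1) * c j := by
  simp only [suffixSum]
  rw [Finset.sum_comm' (t' := Finset.univ) (s' := fun j => Finset.Iic j) (by simp)]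
  simp

theorem sum_suffixSum_succ {n : ℕ} (c : Fin (n + 1) → ℕ) :
    ∑ i : Fin n, suffixSum c i.succ = ∑ j : Fin (n + 1), (j : ℕ) * c j := by
  have h := sum_suffixSum c
  rw [Fin.sum_univ_succ, suffixSum_zero] at h
  simp only [add_mul, one_mul, Finset.sum_add_distrib] at h
  omega

end SuffixSums

/-! ### Bounded tuples, sorting permutations and descents. -/

section Blocks

/-- A number together with a `d`-tuple of numbers bounded by it. -/
abbrev BoundedTuple (d : ℕ) : Type := {p : ℕ × (Fin d → ℕ) // ∀ i, p.2 i ≤ p.1}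

/-- The indicator of the descents of `τ`, as a function of their positions counted from `1`. -/
def descentIndicator {d : ℕ} (τ : Equiv.Perm (Fin d)) : Fin (d + 1) → ℕ :=
  Fin.cons 0 fun i => if i ∈ permDescents τ then 1 else 0

theorem sum_descentIndicator {d : ℕ} (τ : Equiv.Perm (Fin d)) :
    ∑ j, descentIndicator τ j = permDes τ := by
  simp [Fin.sum_univ_succ, descentIndicator, permDes]

theorem sum_mul_descentIndicator {d : ℕ} (τ : Equiv.Perm (Fin d)) :
    ∑ j : Fin (d + 1), (j : ℕ) * descentIndicator τ j = permMaj τ := by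
  simp [Fin.sum_univ_succ, descentIndicator, permMaj, Finset.sum_ite_mem]

theorem castSucc_mem_permDescents {d : ℕ} (τ : Equiv.Perm (Fin (d + 1))) (i : Fin d) :
    i.castSucc ∈ permDescents τ ↔ τ i.succ < τ i.castSucc := by
  simp only [permDescents, Finset.mem_filter, Finset.mem_univ, true_and]
  exact ⟨fun ⟨_, h⟩ => h, fun h => ⟨by simp, h⟩⟩

theorem last_notMem_permDescents {d : ℕ} (τ : Equiv.Perm (Fin (d + 1))) :
    Fin.last d ∉ permDescents τ := by
  simp [permDescents]

/-- The descending sort of `g`, ties being broken by increasing indices, is characterised by its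
behaviour at consecutive positions. -/
theorem eq_sort_toDual_iff {d : ℕ} {g : Fin (d + 1) → ℕ} {τ : Equiv.Perm (Fin (d + 1))} :
    τ = Tuple.sort (OrderDual.toDual ∘ g) ↔ ∀ i : Fin d,
      g (τ i.succ) + (if i.castSucc ∈ permDescents τ then 1 else 0) ≤ g (τ i.castSucc) := by
  -- The stable sort makes the lexicographic pairs (dual value, index) strictly increasing, which is
  -- checked on neighbours.
  rw [Tuple.eq_sort_iff', Fin.strictMono_iff_lt_succ]
  refine forall_congr' fun i => ?_
  have h : τ.trans (Tuple.graphEquiv₁ (OrderDual.toDual ∘ g)) i.castSucc <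
      τ.trans (Tuple.graphEquiv₁ (OrderDual.toDual ∘ g)) i.succ ↔
      g (τ i.succ) < g (τ i.castSucc) ∨
        g (τ i.castSucc) = g (τ i.succ) ∧ τ i.castSucc < τ i.succ :=
    Prod.Lex.toLex_lt_toLex
  have hne : τ i.castSucc ≠ τ i.succ := fun h => i.castSucc_lt_succ.ne (τ.injective h)
  rw [h]
  split_ifs with hd <;> rw [castSucc_mem_permDescents] at hd
  · have := hd.not_gt
    omega
  · have := lt_of_le_of_ne (not_lt.1 hd) hne
    constructor
    · rintro (h | h) <;> omega
    · intro h
      rcases h.lt_or_eq with h | h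
      · exact .inl h
      · exact .inr ⟨h.symm, this⟩

/-- The bounded tuple sorted by `τ` whose consecutive differences in sorted order exceed those that
the descents of `τ` force by the given amounts. -/
def toBoundedTuple {d : ℕ} (x : Σ _ : Equiv.Perm (Fin d), Fin (d + 1) → ℕ) : BoundedTuple d :=
  ⟨(suffixSum (x.2 + descentIndicator x.1) 0,
    fun i => suffixSum (x.2 + descentIndicator x.1) (x.1.symm i).succ), fun i =>
    suffixSum_antitone (x.2 + descentIndicator x.1) (Fin.zero_le (x.1.symm i).succ)⟩

theorem cons_toBoundedTuple {d : ℕ} (τ : Equiv.Perm (Fin d)) (c : Fin (d + 1) → ℕ) :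
    (Fin.cons (toBoundedTuple ⟨τ, c⟩).1.1 ((toBoundedTuple ⟨τ, c⟩).1.2 ∘ τ) : Fin (d + 1) → ℕ) =
      suffixSum (c + descentIndicator τ) := by
  ext i
  cases i using Fin.cases <;> simp [toBoundedTuple]

/-- The added descent indicator supplies exactly the gaps required by `eq_sort_toDual_iff`; hence
`τ` can be recovered from the tuple. -/
theorem eq_sort_toBoundedTuple {d : ℕ} (τ : Equiv.Perm (Fin (d + 1))) (c : Fin (d + 2) → ℕ) :
    τ = Tuple.sort (OrderDual.toDual ∘ (toBoundedTuple ⟨τ, c⟩).1.2) := by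
  rw [eq_sort_toDual_iff]
  intro i
  simp only [toBoundedTuple, Equiv.symm_apply_apply]
  have := suffixSum_castSucc (c + descentIndicator τ) i.succ
  rw [Fin.succ_castSucc, this]
  simp [descentIndicator]
  omega

theorem toBoundedTuple_bijective {d : ℕ} (hd : 1 ≤ d) :
    Function.Bijective (toBoundedTuple (d := d)) := by
  obtain ⟨d, rfl⟩ := Nat.exists_eq_add_of_le' hd
  constructor
  · rintro ⟨τ, c⟩ ⟨τ', c'⟩ h
    obtain rfl : τ = τ' := by
      rw [eq_sort_toBoundedTuple τ c, eq_sort_toBoundedTuple τ' c', h]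
    have h' := cons_toBoundedTuple τ c
    rw [h, cons_toBoundedTuple] at h'
    rw [add_right_cancel (suffixSum_injective h')]
  · rintro ⟨⟨m, g⟩, hg⟩
    dsimp only at hg
    set τ := Tuple.sort (OrderDual.toDual ∘ g) with hτ
    have hτ' := eq_sort_toDual_iff.1 hτ
    let h : Fin (d + 2) → ℕ := Fin.cons m (g ∘ τ)
    -- The gaps of the sorted tuple minus the forced ones; the bounds `hg` and `hτ'` make the
    -- truncated subtractions exact.
    let c : Fin (d + 2) → ℕ := Fin.snoc
      (fun i : Fin (d + 1) => h i.castSucc - h i.succ - descentIndicator τ i.castSucc)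
      (h (Fin.last _))
    have hc : h = suffixSum (c + descentIndicator τ) := by
      rw [eq_suffixSum_iff]
      constructor
      -- The last position is never a descent, so nothing is removed from the smallest entry.
      · have hδ : descentIndicator τ (Fin.last (d + 1)) = 0 := by
          simp [descentIndicator, ← Fin.succ_last, last_notMem_permDescents]
        rw [Pi.add_apply, hδ]
        simp [c]
      · intro i
        suffices h i.succ + descentIndicator τ i.castSucc ≤ h i.castSucc by
          simp only [Pi.add_apply, c, Fin.snoc_castSucc]
          omega
        cases i using Fin.cases with
        | zero => simpa [h, descentIndicator] using hg _
        | succ i => simpa [h, descentIndicator, ← Fin.succ_castSucc] using hτ' i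
    refine ⟨⟨τ, c⟩, Subtype.ext (Prod.ext ?_ ?_)⟩
    · simp [toBoundedTuple, ← hc, h]
    · ext i
      simp [toBoundedTuple, ← hc, h]

theorem toBoundedTuple_fst {d : ℕ} (τ : Equiv.Perm (Fin d)) (c : Fin (d + 1) → ℕ) :
    (toBoundedTuple ⟨τ, c⟩).1.1 = permDes τ + ∑ j, c j := by
  simp only [toBoundedTuple, suffixSum_zero, Pi.add_apply, Finset.sum_add_distrib,
    sum_descentIndicator, add_comm]

theorem sum_toBoundedTuple_snd {d : ℕ} (τ : Equiv.Perm (Fin d)) (c : Fin (d + 1) → ℕ) :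
    ∑ i, (toBoundedTuple ⟨τ, c⟩).1.2 i = permMaj τ + ∑ j : Fin (d + 1), (j : ℕ) * c j := by
  simp only [toBoundedTuple]
  rw [Equiv.sum_comp τ.symm fun i => suffixSum (c + descentIndicator τ) i.succ,
    sum_suffixSum_succ]
  simp only [Pi.add_apply, mul_add, Finset.sum_add_distrib, sum_mul_descentIndicator, add_comm]

end Blocks

/-! ### Cutting a partition diamond into bounded tuples. -/

namespace PartitionDiamond

variable {d M : ℕ}

/-- A partition diamond is determined by its last link, the drops between consecutive links, and
the heights of the folds above the link to their right. -/
def equivBoundedTuples (hd : 1 ≤ d) : PartitionDiamond d M ≃ ℕ × (Fin M → BoundedTuple d) where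
  toFun p := (p.link (Fin.last M), fun n =>
    ⟨(p.link n.castSucc - p.link n.succ, fun i => p.fold n i - p.link n.succ),
      fun i => Nat.sub_le_sub_right (p.fold_le_link n i) _⟩)
  invFun q :=
    { link := suffixSum (Fin.snoc (fun n => (q.2 n).1.1) q.1 : Fin (M + 1) → ℕ)
      fold := fun n i => (q.2 n).1.2 i +
        suffixSum (Fin.snoc (fun n => (q.2 n).1.1) q.1 : Fin (M + 1) → ℕ) n.succ
      fold_le_link := fun n i => by
        rw [suffixSum_castSucc, Fin.snoc_castSucc]
        exact Nat.add_le_add_right ((q.2 n).2 i) _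
      link_le_fold := fun n i => Nat.le_add_left _ _ }
  left_inv p := by
    have h : suffixSum (Fin.snoc (fun n : Fin M => p.link n.castSucc - p.link n.succ)
        (p.link (Fin.last M)) : Fin (M + 1) → ℕ) = p.link := by
      symm
      rw [eq_suffixSum_iff]
      refine ⟨by simp, fun n => ?_⟩
      rw [Fin.snoc_castSucc, Nat.sub_add_cancel]
      -- Consecutive links are comparable only through a fold between them, so one must exist.
      exact (p.link_le_fold n ⟨0, hd⟩).trans (p.fold_le_link n ⟨0, hd⟩)
    ext n i
    · simp [h]
    · simp [h, Nat.sub_add_cancel (p.link_le_fold n i)]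
  right_inv q := by
    refine Prod.ext (by simp [suffixSum_last]) (funext fun n => Subtype.ext (Prod.ext ?_ ?_))
    · simp [suffixSum_castSucc]
    · simp

theorem linkSum_equivBoundedTuples_symm (hd : 1 ≤ d) (q : ℕ × (Fin M → BoundedTuple d)) :
    ((equivBoundedTuples hd).symm q).linkSum =
      (M + 1) * q.1 + ∑ n : Fin M, ((n : ℕ) + 1) * (q.2 n).1.1 := by
  refine (sum_suffixSum _).trans ?_
  simp [Fin.sum_univ_castSucc, add_comm]

theorem foldSum_equivBoundedTuples_symm (hd : 1 ≤ d) (q : ℕ × (Fin M → BoundedTuple d)) :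
    ((equivBoundedTuples hd).symm q).foldSum =
      d * M * q.1 + ∑ n : Fin M, (∑ i, (q.2 n).1.2 i + d * n * (q.2 n).1.1) := by
  have h := sum_suffixSum_succ (Fin.snoc (fun n => (q.2 n).1.1) q.1 : Fin (M + 1) → ℕ)
  simp only [Fin.sum_univ_castSucc, Fin.snoc_castSucc, Fin.snoc_last, Fin.val_castSucc,
    Fin.val_last] at h
  simp only [foldSum, equivBoundedTuples, Equiv.coe_fn_symm_mk, Finset.sum_add_distrib,
    Finset.sum_const, Finset.card_univ, Fintype.card_fin, smul_eq_mul, ← Finset.mul_sum, h]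
  simp only [mul_add, Finset.mul_sum, mul_assoc]
  ring

end PartitionDiamond

/-! ### Series of one block and of the whole diamond. -/

section DiamondSeries

open MvPowerSeries

/-- The exponent of `a ^ i * b ^ j`. -/
noncomputable def bidegree (i j : ℕ) : Fin 2 →₀ ℕ := Finsupp.single 0 i + Finsupp.single 1 j

theorem monomial_bidegree (i j : ℕ) :
    monomial (bidegree i j) (1 : ℤ) = X (0 : Fin 2) ^ i * X (1 : Fin 2) ^ j := by
  rw [X_pow_eq, X_pow_eq, monomial_mul_monomial, one_mul, bidegree]

theorem bidegree_add (i j i' j' : ℕ) :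
    bidegree i j + bidegree i' j' = bidegree (i + i') (j + j') := by
  simp only [bidegree, Finsupp.single_add]
  abel

theorem smul_bidegree (k i j : ℕ) : k • bidegree i j = bidegree (k * i) (k * j) := by
  simp [bidegree, smul_add]

theorem sum_bidegree {ι : Type*} (s : Finset ι) (i j : ι → ℕ) :
    ∑ x ∈ s, bidegree (i x) (j x) = bidegree (∑ x ∈ s, i x) (∑ x ∈ s, j x) := by
  simp only [bidegree, Finset.sum_add_distrib, Finsupp.single_finsetSum]

theorem bidegree_succ_ne_zero (i j : ℕ) : bidegree i (j + 1) ≠ 0 := fun h => by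
  simpa [bidegree] using DFunLike.congr_fun h 1

theorem bidegree_eq_iff (i j : ℕ) (e : Fin 2 →₀ ℕ) : bidegree i j = e ↔ i = e 0 ∧ j = e 1 := by
  rw [Finsupp.ext_iff, Fin.forall_fin_two]
  simp [bidegree]

/-- The weight of a bounded tuple that sits in the diamond between links `n` and `n + 1`. -/
noncomputable def blockWeight (d n : ℕ) (p : BoundedTuple d) : Fin 2 →₀ ℕ :=
  bidegree (∑ i, p.1.2 i + d * n * p.1.1) ((n + 1) * p.1.1)

/-- The weights of the difference vectors of bounded tuples with a given sorting permutation. -/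
noncomputable def differenceWeight (d n : ℕ) (c : Fin (d + 1) → ℕ) : Fin 2 →₀ ℕ :=
  ∑ j : Fin (d + 1), c j • bidegree (d * n + j) (n + 1)

theorem blockWeight_toBoundedTuple {d : ℕ} (n : ℕ) (τ : Equiv.Perm (Fin d))
    (c : Fin (d + 1) → ℕ) : blockWeight d n (toBoundedTuple ⟨τ, c⟩) =
      bidegree (permMaj τ + d * n * permDes τ) ((n + 1) * permDes τ) + differenceWeight d n c := by
  simp only [blockWeight, differenceWeight, toBoundedTuple_fst, sum_toBoundedTuple_snd,
    smul_bidegree, sum_bidegree, bidegree_add]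
  congr 1
  · simp only [mul_add, Finset.sum_add_distrib, ← Finset.sum_mul, mul_comm]
    ring
  · rw [← Finset.sum_mul]
    ring

theorem differenceWeight_series (d n : ℕ) :
    FiniteWeights (differenceWeight d n) ∧
      weightSeries (differenceWeight d n) * ∏ j ∈ Finset.range (d + 1),
        (1 - (X 0 : MvPowerSeries (Fin 2) ℤ) ^ (d * n + j) * X 1 ^ (n + 1)) = 1 := by
  obtain ⟨h1, h2⟩ := FiniteWeights.pi_and_weightSeries_pi
    (w := fun (j : Fin (d + 1)) (k : ℕ) => k • bidegree (d * n + j) (n + 1))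
    fun j => .smul (bidegree_succ_ne_zero _ _)
  refine ⟨h1, ?_⟩
  unfold differenceWeight
  rw [h2, Finset.prod_range, ← Finset.prod_mul_distrib]
  refine Finset.prod_eq_one fun j _ => ?_
  rw [← monomial_bidegree]
  exact weightSeries_smul_mul (bidegree_succ_ne_zero _ _)

/-- Carlitz's identity for the joint distribution of `des` and `maj`, with `x = a ^ (dn) b ^ (n+1)`
and `q = a`. -/
theorem blockWeight_series {d : ℕ} (hd : 1 ≤ d) (n : ℕ) :
    FiniteWeights (blockWeight d n) ∧
      weightSeries (blockWeight d n) * ∏ j ∈ Finset.range (d + 1),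
        (1 - (X 0 : MvPowerSeries (Fin 2) ℤ) ^ (d * n + j) * X 1 ^ (n + 1)) =
      eulerMahonian d ((X 0 : MvPowerSeries (Fin 2) ℤ) ^ (d * n) * X 1 ^ (n + 1)) (X 0) := by
  obtain ⟨hf, hs⟩ := differenceWeight_series d n
  let w (τ : Equiv.Perm (Fin d)) (c : Fin (d + 1) → ℕ) : Fin 2 →₀ ℕ :=
    bidegree (permMaj τ + d * n * permDes τ) ((n + 1) * permDes τ) + differenceWeight d n c
  have hw (τ : Equiv.Perm (Fin d)) : FiniteWeights (w τ) := hf.const_add _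
  let φ := (Equiv.ofBijective _ (toBoundedTuple_bijective hd)).symm
  have hφ (p : BoundedTuple d) : w (φ p).1 (φ p).2 = blockWeight d n p := by
    refine (blockWeight_toBoundedTuple n _ _).symm.trans ?_
    exact congrArg _ (Equiv.ofBijective_apply_symm_apply _ (toBoundedTuple_bijective hd) p)
  refine ⟨(FiniteWeights.sigma hw).of_equiv φ hφ, ?_⟩
  rw [weightSeries_congr_equiv (v := fun x => w x.1 x.2) φ hφ, weightSeries_sigma hw,
    Finset.sum_mul]
  refine Finset.sum_congr rfl fun τ _ => ?_
  rw [weightSeries_const_add _ hf, mul_assoc, hs, mul_one, monomial_bidegree]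
  ring

namespace PartitionDiamond

variable {d M : ℕ}

theorem bidegree_equivBoundedTuples_symm (hd : 1 ≤ d) (q : ℕ × (Fin M → BoundedTuple d)) :
    bidegree ((equivBoundedTuples hd).symm q).foldSum ((equivBoundedTuples hd).symm q).linkSum =
      q.1 • bidegree (M * d) (M + 1) + ∑ n : Fin M, blockWeight d n (q.2 n) := by
  simp only [blockWeight, smul_bidegree, sum_bidegree, bidegree_add,
    foldSum_equivBoundedTuples_symm, linkSum_equivBoundedTuples_symm]
  congr 2 <;> ring

theorem sigma_eq_weightSeries :
    sigma d M = weightSeries fun p : PartitionDiamond d M => bidegree p.foldSum p.linkSum := by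
  ext e
  rw [coeff_weightSeries]
  simp only [bidegree_eq_iff]
  rfl

theorem bidegree_series (hd : 1 ≤ d) :
    FiniteWeights (fun p : PartitionDiamond d M => bidegree p.foldSum p.linkSum) ∧
      weightSeries (fun p : PartitionDiamond d M => bidegree p.foldSum p.linkSum) *
        diamondDenominator d M (X 0) (X 1) = diamondNumerator d M (X 0) (X 1) := by
  obtain ⟨hf, hs⟩ := FiniteWeights.pi_and_weightSeries_pi
    (w := fun n : Fin M => blockWeight d n) fun n => (blockWeight_series hd n).1
  have hm := bidegree_succ_ne_zero (M * d) M
  have h (p : PartitionDiamond d M) := (equivBoundedTuples hd).symm_apply_apply p ▸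
    (bidegree_equivBoundedTuples_symm hd (equivBoundedTuples hd p)).symm
  refine ⟨((FiniteWeights.smul hm).prod hf).of_equiv _ h, ?_⟩
  have hden : ∏ n ∈ Finset.Icc 1 M, ∏ j ∈ Finset.range (d + 1),
      (1 - (X 0 : MvPowerSeries (Fin 2) ℤ) ^ (n * d - j) * X 1 ^ n) =
      ∏ n : Fin M, ∏ j ∈ Finset.range (d + 1),
        (1 - (X 0 : MvPowerSeries (Fin 2) ℤ) ^ (d * n + j) * X 1 ^ ((n : ℕ) + 1)) := by
    rw [← Finset.prod_range fun n => ∏ j ∈ Finset.range (d + 1),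
      (1 - (X 0 : MvPowerSeries (Fin 2) ℤ) ^ (d * n + j) * X 1 ^ (n + 1)),
      ← Finset.Ico_add_one_right_eq_Icc,
      Finset.prod_Ico_eq_prod_range, add_tsub_cancel_right]
    refine Finset.prod_congr rfl fun n _ => ?_
    -- Reversing `j` to `d - j` turns the exponent `(n + 1) * d - j` into `d * n + j`.
    rw [← Finset.prod_range_reflect]
    refine Finset.prod_congr rfl fun j hj => ?_
    have hj := Finset.mem_range.1 hj
    have : (1 + n) * d - (d + 1 - 1 - j) = d * n + j := by
      rw [add_mul, one_mul, mul_comm n d]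
      omega
    rw [this, add_comm 1 n]
  have hnum : diamondNumerator d M (X 0 : MvPowerSeries (Fin 2) ℤ) (X 1) = ∏ n : Fin M,
      eulerMahonian d ((X 0 : MvPowerSeries (Fin 2) ℤ) ^ (d * n) * X 1 ^ ((n : ℕ) + 1)) (X 0) := by
    rw [diamondNumerator, ← Finset.prod_range fun n => eulerMahonian d
      ((X 0 : MvPowerSeries (Fin 2) ℤ) ^ (d * n) * X 1 ^ (n + 1)) (X 0),
      ← Finset.Ico_add_one_right_eq_Icc,
      Finset.prod_Ico_eq_prod_range, add_tsub_cancel_right]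
    refine Finset.prod_congr rfl fun n _ => ?_
    rw [add_tsub_cancel_left, add_comm 1 n, mul_comm n d]
  rw [weightSeries_congr_equiv (equivBoundedTuples hd)
    (v := fun q => q.1 • bidegree (M * d) (M + 1) + ∑ n : Fin M, blockWeight d n (q.2 n)) h,
    weightSeries_prod (.smul hm) hf, hs, diamondDenominator, hden,
    hnum, mul_mul_mul_comm, ← monomial_bidegree, weightSeries_smul_mul hm, one_mul,
    ← Finset.prod_mul_distrib]
  exact Finset.prod_congr rfl fun n _ => (blockWeight_series hd n).2

/-- Each factor subtracts a monomial with a positive power of `b`, so the constant coefficient is 1.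
-/
theorem isUnit_diamondDenominator (d M : ℕ) :
    IsUnit (diamondDenominator d M (X 0 : MvPowerSeries (Fin 2) ℤ) (X 1)) := by
  rw [isUnit_iff_constantCoeff, diamondDenominator]
  simp only [map_mul, map_prod, map_sub, map_one, map_pow, constantCoeff_X]
  rw [zero_pow M.succ_ne_zero, mul_zero, sub_zero, one_mul, Finset.prod_eq_one]
  · exact isUnit_one
  · intro n hn
    rw [zero_pow (Nat.one_le_iff_ne_zero.1 (Finset.mem_Icc.1 hn).1)]
    simp

end PartitionDiamond

end DiamondSeries

theorem theorem2 (d M : ℕ) (hd : 1 ≤ d) (a b : MvPowerSeries (Fin 2) ℤ)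
    (ha : a = MvPowerSeries.X 0) (hb : b = MvPowerSeries.X 1) :
    (∀ k l : ℕ, (PartitionDiamond.withSums d M k l).Finite) ∧
    IsUnit (diamondDenominator d M a b) ∧
    PartitionDiamond.sigma d M =
      diamondNumerator d M a b * Ring.inverse (diamondDenominator d M a b) := by
  subst ha hb
  obtain ⟨hf, hs⟩ := PartitionDiamond.bidegree_series (M := M) hd
  have hu := PartitionDiamond.isUnit_diamondDenominator d M
  refine ⟨fun k l => ?_, hu, ?_⟩
  · have h := hf (bidegree k l)
    simp only [bidegree_eq_iff k l (bidegree k l) |>.1 rfl |>.1.symm,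
      bidegree_eq_iff k l (bidegree k l) |>.1 rfl |>.2.symm, bidegree_eq_iff] at h
    exact Set.finite_coe_iff.1 h
  · rw [Ring.eq_mul_inverse_iff_mul_eq _ _ _ hu, PartitionDiamond.sigma_eq_weightSeries, hs]
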